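/- For $n \ge 1$, draw a random graph $G \sim G(n,1/2)$ and, independently, a uniformly random ordering of its $n$ vertices. Scan the vertices in this order, starting from the empty set and adding each vertex that is not adjacent to any vertex added so far; let $\mathbf{k}=\mathbf{k}_n$ be the size of the resulting stable set. Let $\mathbf{H} = \sum_{i=1}^{\infty} E_i$, where $E_1,E_2,\dots$ are independent and $E_i$ is exponentially distributed with rate $2^i$ (the series converges almost surely). Let $\theta=\theta_n = \log_2 n - \lfloor \log_2 n\rfloor$ be the fractional part of $\log_2 n$, and set $$\mathbf{h} = \mathbf{h}_n = \lfloor \log_2(1/\mathbf{H}) + \theta \rfloor .$$ Then the total variation distance between the integer random variables $\mathbf{k} - \lfloor \log_2 n \rfloor$ and $\mathbf{h}$ is $\tilde O(n^{-1/3})$ as $n\to\infty$; that is, there are an integer $a \ge 0$ and a constant $C$ such that for all sufficiently large $n$ $$\sup_{A \subseteq \mathbb{Z}} \bigl| \Pr[\mathbf{k} - \lfloor \log_2 n \rfloor \in A] - \Pr[\mathbf{h} \in A] \bigr| \le C\, n^{-1/3} (\log n)^{a}.$$ -/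

import Mathlib

open MeasureTheory ProbabilityTheory Filter Asymptotics

noncomputable section

/-! ### The greedy heuristic and its output size -/

/-- Scan the vertices in the order of the list `l`, starting from the empty set, and add a vertex
whenever it is not adjacent to any of the vertices added so far. -/
def greedyStableSet {V : Type*} (G : SimpleGraph V) (l : List V) : Finset V :=
  open scoped Classical in
  l.foldl (fun S v => if ∀ u ∈ S, ¬ G.Adj u v then insert v S else S) ∅

/-- The order in which the permutation `σ` scans the vertices: `σ 0`, `σ 1`, …, `σ (n - 1)`. -/
def scanOrder {n : ℕ} (σ : Equiv.Perm (Fin n)) : List (Fin n) :=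
  List.ofFn σ

/-- The set of permutations is finite; it carries the discrete σ-algebra. -/
instance permMeasurableSpace (n : ℕ) : MeasurableSpace (Equiv.Perm (Fin n)) := ⊤

instance permDiscreteMeasurableSpace (n : ℕ) :
    DiscreteMeasurableSpace (Equiv.Perm (Fin n)) := ⟨fun _ => trivial⟩

/-- The parameter `1/2`, as an element of the unit interval. -/
def oneHalf : unitInterval := ⟨1 / 2, by norm_num, by norm_num⟩

/-- The joint law of a `G(n, 1/2)` random graph and an independent uniformly random order
of its vertices. -/
def graphOrderMeasure (n : ℕ) : Measure (SimpleGraph (Fin n) × Equiv.Perm (Fin n)) :=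
  (SimpleGraph.binomialRandom (Fin n) oneHalf).prod (uniformOn Set.univ)

/-- The size of the stable set found by the greedy heuristic, as a random variable. -/
def greedySize (n : ℕ) (x : SimpleGraph (Fin n) × Equiv.Perm (Fin n)) : ℕ :=
  (greedyStableSet x.1 (scanOrder x.2)).card

/-! ### The sum of independent exponentials with rates `2, 4, 8, …` -/

/-- The law of a sequence of independent exponential random variables, the `i`-th of which
(`i = 0, 1, 2, …`) has rate `2 ^ (i + 1)`. -/
def expSeqMeasure : Measure (ℕ → ℝ) :=
  Measure.infinitePi fun i : ℕ => expMeasure (2 ^ (i + 1))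

/-- The random variable `∑_{i ≥ 1} Exp(2 ^ i)`. -/
def hypo (ω : ℕ → ℝ) : ℝ := ∑' i, ω i

/-! ### The two integer random variables, the distance and the rate -/

/-- The law of (greedy stable set size) `- ⌊log₂ n⌋`. -/
def centeredSizeLaw (n : ℕ) : Measure ℤ :=
  (graphOrderMeasure n).map fun x => (greedySize n x : ℤ) - ⌊Real.logb 2 n⌋

/-- The law of `⌊log₂ (1 / H) + θ⌋`, where `H = ∑_{i ≥ 1} Exp(2 ^ i)` and `θ` is the fractional
part of `log₂ n`. -/
def hLaw (n : ℕ) : Measure ℤ :=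
  expSeqMeasure.map fun ω => ⌊Real.logb 2 (1 / hypo ω) + Int.fract (Real.logb 2 n)⌋

/-- The variation distance `sup_A |μ(A) - ν(A)|`, over all measurable sets `A`. -/
def tvDist {α : Type*} [MeasurableSpace α] (μ ν : Measure α) : ℝ :=
  ⨆ A : {A : Set α // MeasurableSet A}, |μ.real A - ν.real A|

/-- `f = Õ(g)` as `n → ∞`: the function `f` is `O(g)` up to a fixed power of `log n`. -/
def IsSoftO (f g : ℕ → ℝ) : Prop :=
  ∃ a : ℕ, f =O[atTop] fun n => g n * Real.log n ^ a

/-! ### The objects above are well defined -/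

instance expSeq_isProbabilityMeasure_factor (i : ℕ) :
    IsProbabilityMeasure (expMeasure ((2 : ℝ) ^ (i + 1))) :=
  isProbabilityMeasure_expMeasure (by positivity)

instance : IsProbabilityMeasure expSeqMeasure := by
  unfold expSeqMeasure; infer_instance

instance (n : ℕ) : IsProbabilityMeasure (graphOrderMeasure n) := by
  have : IsProbabilityMeasure (uniformOn (Set.univ : Set (Equiv.Perm (Fin n)))) :=
    isProbabilityMeasure_uniformOn Set.finite_univ Set.univ_nonempty
  unfold graphOrderMeasure; infer_instance

theorem measurable_greedySize (n : ℕ) : Measurable (greedySize n) := by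
  have h : MeasurableSingletonClass (SimpleGraph (Fin n)) := by
    refine ⟨fun G => ?_⟩
    have := SimpleGraph.measurableEmbedding_edgeSet (V := Fin n)
    have h2 : ({G} : Set (SimpleGraph (Fin n)))
        = SimpleGraph.edgeSet ⁻¹' {G.edgeSet} := by
      ext; simp
    rw [h2]
    exact this.measurable (measurableSet_singleton _)
  exact measurable_of_finite _

instance (n : ℕ) : IsProbabilityMeasure (centeredSizeLaw n) :=
  Measure.isProbabilityMeasure_map
    ((measurable_of_countable fun k : ℕ => (k : ℤ) - ⌊Real.logb 2 n⌋).comp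
      (measurable_greedySize n)).aemeasurable

theorem lintegral_expMeasure_le {r : ℝ} (hr : 0 < r) :
    ∫⁻ x, ENNReal.ofReal |x| ∂(expMeasure r) ≤ ENNReal.ofReal (1 / r) := by
  have hm : Measurable (gammaPDF 1 r) := (measurable_gammaPDFReal 1 r).ennreal_ofReal
  have hm2 : Measurable (gammaPDF 2 r) := (measurable_gammaPDFReal 2 r).ennreal_ofReal
  have h : ∀ x, (gammaPDF 1 r * fun x => ENNReal.ofReal |x|) x
      = ENNReal.ofReal (1 / r) * gammaPDF 2 r x := by
    intro x
    rcases lt_or_ge x 0 with hx | hx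
    · simp [gammaPDF_of_neg hx]
    · have hG : Real.Gamma 2 = 1 := Real.Gamma_two
      rw [Pi.mul_apply, gammaPDF_of_nonneg hx, gammaPDF_of_nonneg hx,
        ← ENNReal.ofReal_mul' (abs_nonneg x), ← ENNReal.ofReal_mul (by positivity),
        abs_of_nonneg hx, hG, Real.Gamma_one]
      congr 1
      norm_num
      field_simp
  rw [expMeasure, gammaMeasure, lintegral_withDensity_eq_lintegral_mul _ hm (by fun_prop),
    lintegral_congr h, lintegral_const_mul _ hm2,
    lintegral_gammaPDF_eq_one (by norm_num) hr, mul_one]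

/-- The series defining `hypo` converges almost surely. -/
theorem ae_summable_expSeq : ∀ᵐ ω ∂expSeqMeasure, Summable ω := by
  have hm : ∀ i : ℕ, Measurable fun ω : ℕ → ℝ => ENNReal.ofReal |ω i| := fun i => by fun_prop
  have h : ∫⁻ ω, ∑' i, ENNReal.ofReal |ω i| ∂expSeqMeasure ≠ ⊤ := by
    rw [lintegral_tsum (fun i => (hm i).aemeasurable)]
    have h1 : ∀ i : ℕ, ∫⁻ ω, ENNReal.ofReal |ω i| ∂expSeqMeasure
        ≤ ENNReal.ofReal ((1 / 2) ^ (i + 1)) := by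
      intro i
      have h2 := (measurePreserving_eval_infinitePi
        (fun i : ℕ => expMeasure ((2 : ℝ) ^ (i + 1))) i).lintegral_comp
        (f := fun x => ENNReal.ofReal |x|) (by fun_prop)
      refine (h2.le.trans (lintegral_expMeasure_le (by positivity))).trans_eq ?_
      rw [one_div_pow]
    refine ne_top_of_le_ne_top ?_ (ENNReal.tsum_le_tsum h1)
    rw [← ENNReal.ofReal_tsum_of_nonneg (fun i => by positivity)]
    · exact ENNReal.ofReal_ne_top
    · exact (summable_nat_add_iff 1).2 summable_geometric_two
  have h3 := ae_lt_top (Measurable.tsum hm) h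
  filter_upwards [h3] with ω hω
  have := ENNReal.summable_toReal hω.ne
  simp only [abs_nonneg, ENNReal.toReal_ofReal] at this
  exact this.of_abs

theorem aemeasurable_hypo : AEMeasurable hypo expSeqMeasure := by
  refine aemeasurable_of_tendsto_metrizable_ae atTop
    (f := fun (n : ℕ) (ω : ℕ → ℝ) => ∑ i ∈ Finset.range n, ω i)
    (fun n => by fun_prop) ?_
  filter_upwards [ae_summable_expSeq] with ω hω
  exact hω.hasSum.tendsto_sum_nat

instance (n : ℕ) : IsProbabilityMeasure (hLaw n) := by
  refine Measure.isProbabilityMeasure_map ?_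
  have : Measurable fun x : ℝ => ⌊Real.logb 2 (1 / x) + Int.fract (Real.logb 2 n)⌋ := by
    unfold Real.logb
    fun_prop
  exact this.comp_aemeasurable aemeasurable_hypo

end

noncomputable section

/-! ### The law of the greedy size -/

/-! When the current stable set has `i` elements, a new vertex is accepted with probability `2 ^
(-i)`, independently of the past, since its edges to earlier vertices have not been examined. So the
set reaches size `m` at a time distributed as a sum of independent geometric variables with success
probabilities `1, 1/2, …, 2 ^ (1 - m)`, and `sizeTail m n` is the probability that this sum is at
most `n`. The order of the vertices plays no role.

A geometric variable is a rounded exponential. Coupling the one of success probability `2 ^ (-i)` to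
the exponential of index `j = m - 1 - i` gives every summand the same scale `2 ^ i * 2 ^ (j + 1) = 2
^ m`, so the sum is close to `2 ^ m * H`: it exceeds it by at most `m`, and falls short by at most
`deviation m`, of mean at most `m + 1`. As `H` has density at most `2`, shifting a threshold for `2
^ m * H` by `c` changes a probability by at most `2 * c / 2 ^ m`. This yields `abs_sizeTail_sub_le`.

The event `2 ^ m * H ≤ n` is exactly `h ≥ m - ⌊log₂ n⌋` (`hLaw_real_Ici`), so the tails of the two
laws are compared directly. Only the `O(log n)` values of `m` between `(2/3) log₂ n` and `2 log₂ n`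
matter; outside this window the mass is controlled by Markov's inequality and the density bound
(`tvDist_le_of_abs_tail_sub_le`). -/

/-- The probability that the greedy stable set has at least `m` elements after `t` vertices. -/
def sizeTail : ℕ → ℕ → ℝ
  | 0, _ => 1
  | _ + 1, 0 => 0
  | m + 1, t + 1 => (1 - (1 / 2) ^ m) * sizeTail (m + 1) t + (1 / 2) ^ m * sizeTail m t

section Greedy

variable {V : Type*}

open scoped Classical in
theorem greedyStableSet_append_singleton (G : SimpleGraph V) (l : List V) (v : V) :
    greedyStableSet G (l ++ [v]) =
      if ∀ u ∈ greedyStableSet G l, ¬ G.Adj u v then insert v (greedyStableSet G l)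
      else greedyStableSet G l := by
  unfold greedyStableSet
  rw [List.foldl_append]
  simp only [List.foldl_cons, List.foldl_nil]

theorem mem_of_mem_greedyStableSet (G : SimpleGraph V) (l : List V) {v : V}
    (hv : v ∈ greedyStableSet G l) : v ∈ l := by
  classical
  induction l using List.reverseRecOn with
  | nil => simp [greedyStableSet] at hv
  | append_singleton l w ih =>
    rw [greedyStableSet_append_singleton] at hv
    split_ifs at hv with h
    · rcases Finset.mem_insert.1 hv with rfl | h'
      · simp
      · simp [ih h']
    · simp [ih hv]

theorem greedyStableSet_congr {G G' : SimpleGraph V} (l : List V)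
    (h : ∀ u ∈ l, ∀ w ∈ l, G.Adj u w ↔ G'.Adj u w) :
    greedyStableSet G l = greedyStableSet G' l := by
  classical
  induction l using List.reverseRecOn with
  | nil => rfl
  | append_singleton l w ih =>
    rw [greedyStableSet_append_singleton, greedyStableSet_append_singleton,
      ih fun u hu w hw => h u (by simp [hu]) w (by simp [hw])]
    have : (∀ u ∈ greedyStableSet G' l, ¬ G.Adj u w) ↔
        ∀ u ∈ greedyStableSet G' l, ¬ G'.Adj u w := by
      refine forall₂_congr fun u hu => not_congr (h u ?_ w (by simp))
      simp [mem_of_mem_greedyStableSet _ _ hu]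
    simp only [this]

variable [Fintype V]

instance : MeasurableSingletonClass (SimpleGraph V) := by
  refine ⟨fun G => ?_⟩
  have h : ({G} : Set (SimpleGraph V)) = SimpleGraph.edgeSet ⁻¹' {G.edgeSet} := by ext; simp
  rw [h]
  exact SimpleGraph.measurableEmbedding_edgeSet.measurable (measurableSet_singleton _)

theorem measurableSet_simpleGraph (E : Set (SimpleGraph V)) : MeasurableSet E :=
  E.toFinite.measurableSet

/-- Edges and non-edges both weigh `1/2`, so the law is uniform and every bijection of the set of
graphs preserves it. -/
theorem binomialRandom_oneHalf_singleton (G : SimpleGraph V) :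
    SimpleGraph.binomialRandom V oneHalf {G} = 2⁻¹ ^ ((Nat.card V).choose 2) := by
  classical
  rw [SimpleGraph.binomialRandom_singleton]
  have h1 : (unitInterval.toNNReal oneHalf : ENNReal) = 2⁻¹ := by
    rw [← ENNReal.coe_two, ← ENNReal.coe_inv (by norm_num)]
    congr 1
    ext
    simp [oneHalf]
  have h2 : (unitInterval.toNNReal (unitInterval.symm oneHalf) : ENNReal) = 2⁻¹ := by
    rw [← ENNReal.coe_two, ← ENNReal.coe_inv (by norm_num)]
    congr 1
    ext
    simp [oneHalf]
    norm_num
  rw [h1, h2, ← pow_add, Nat.add_sub_cancel']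
  have h3 := G.card_edgeFinset_le_card_choose_two
  rwa [Nat.card_eq_fintype_card, Set.ncard_eq_toFinset_card', ← SimpleGraph.edgeFinset]

theorem binomialRandom_oneHalf_preimage (f : SimpleGraph V ≃ SimpleGraph V)
    (E : Set (SimpleGraph V)) :
    SimpleGraph.binomialRandom V oneHalf (f ⁻¹' E) = SimpleGraph.binomialRandom V oneHalf E := by
  classical
  have : Fintype (SimpleGraph V) := Fintype.ofFinite _
  have h (E : Set (SimpleGraph V)) : SimpleGraph.binomialRandom V oneHalf E
      = ∑ G : SimpleGraph V, if G ∈ E then 2⁻¹ ^ ((Nat.card V).choose 2) else 0 := by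
    rw [← Finset.sum_filter, ← Measure.sum_smul_dirac (SimpleGraph.binomialRandom V oneHalf),
      Measure.sum_apply _ (measurableSet_simpleGraph E), tsum_fintype, Finset.sum_filter]
    refine Finset.sum_congr rfl fun G _ => ?_
    rw [Measure.smul_apply, Measure.dirac_apply' _ (measurableSet_simpleGraph E),
      binomialRandom_oneHalf_singleton]
    simp [Set.indicator_apply]
  rw [h E, h (f ⁻¹' E)]
  exact Equiv.sum_comp f fun G => if G ∈ E then (2⁻¹ : ENNReal) ^ ((Nat.card V).choose 2) else 0

open scoped symmDiff in
/-- If an event does not depend on the edge `uv`, then the absence of this edge halves it. -/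
theorem binomialRandom_inter_not_adj {u v : V} (huv : u ≠ v) {E : Set (SimpleGraph V)}
    (hE : ∀ G, G ∆ SimpleGraph.edge u v ∈ E ↔ G ∈ E) :
    (SimpleGraph.binomialRandom V oneHalf).real (E ∩ {G | ¬ G.Adj u v})
      = 1 / 2 * (SimpleGraph.binomialRandom V oneHalf).real E := by
  set μ := SimpleGraph.binomialRandom V oneHalf
  have h1 : μ.real (E ∩ {G | G.Adj u v}) = μ.real (E ∩ {G | ¬ G.Adj u v}) := by
    -- Toggling the edge `uv` preserves the law and `E`, and exchanges its presence and absence.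
    have hinv : Function.Involutive fun G : SimpleGraph V => G ∆ SimpleGraph.edge u v :=
      fun G => symmDiff_symmDiff_cancel_right _ _
    have := binomialRandom_oneHalf_preimage hinv.toPerm (E ∩ {G | ¬ G.Adj u v})
    rw [measureReal_def, measureReal_def, ← this]
    congr 2
    ext G
    simp only [Set.mem_inter_iff, Set.mem_ofPred_eq, Set.mem_preimage,
      Function.Involutive.coe_toPerm, hE]
    simp [symmDiff_def, SimpleGraph.edge_adj, huv]
  have h2 := measureReal_inter_add_sdiff (μ := μ) (s := E)
    (measurableSet_simpleGraph {G | G.Adj u v})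
  have h3 : E \ {G | G.Adj u v} = E ∩ {G | ¬ G.Adj u v} := rfl
  rw [h3] at h2
  linarith

-- The edges from `v` to `A` are exposed one by one; what has been required so far does not involve
-- the next edge, so each costs a factor `1/2`.
open scoped symmDiff in
theorem binomialRandom_inter_forall_not_adj {v : V} (A : Finset V) (hv : v ∉ A)
    {E : Set (SimpleGraph V)}
    (hE : ∀ u ∈ A, ∀ G, G ∆ SimpleGraph.edge u v ∈ E ↔ G ∈ E) :
    (SimpleGraph.binomialRandom V oneHalf).real (E ∩ {G | ∀ u ∈ A, ¬ G.Adj u v})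
      = (1 / 2) ^ A.card * (SimpleGraph.binomialRandom V oneHalf).real E := by
  classical
  induction A using Finset.induction_on with
  | empty => simp
  | insert a A ha ih =>
    rw [Finset.mem_insert, not_or] at hv
    have h1 : E ∩ {G | ∀ u ∈ insert a A, ¬ G.Adj u v}
        = (E ∩ {G | ∀ u ∈ A, ¬ G.Adj u v}) ∩ {G | ¬ G.Adj a v} := by
      ext G
      simp only [Finset.mem_insert, forall_eq_or_imp, Set.mem_inter_iff, Set.mem_ofPred_eq]
      tauto
    rw [h1, binomialRandom_inter_not_adj (Ne.symm hv.1),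
      ih hv.2 fun u hu => hE u (Finset.mem_insert_of_mem hu), Finset.card_insert_of_notMem ha]
    · ring
    · intro G
      refine and_congr (hE a (Finset.mem_insert_self _ _) G) ?_
      refine forall₂_congr fun u hu => ?_
      have hua : u ≠ a := fun h => ha (h ▸ hu)
      have huv : u ≠ v := fun h => hv.2 (h ▸ hu)
      simp [symmDiff_def, SimpleGraph.edge_adj, hua, huv]

/-- Appending a vertex to the list reproduces the recursion of `sizeTail`: size `m + 1` is either
already reached, or the size is exactly `m` and the new vertex is accepted. -/
theorem binomialRandom_le_card_greedyStableSet (l : List V) (hl : l.Nodup) (m : ℕ) :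
    (SimpleGraph.binomialRandom V oneHalf).real {G | m ≤ (greedyStableSet G l).card}
      = sizeTail m l.length := by
  classical
  set μ := SimpleGraph.binomialRandom V oneHalf
  induction l using List.reverseRecOn generalizing m with
  | nil => cases m <;> simp [greedyStableSet, sizeTail]
  | append_singleton l v ih =>
    have hvl : v ∉ l := by
      rw [List.nodup_append] at hl
      intro h
      exact hl.2.2 v h v (by simp) rfl
    replace ih := ih (List.nodup_append.1 hl).1
    have hvg (G : SimpleGraph V) : v ∉ greedyStableSet G l :=
      fun h => hvl (mem_of_mem_greedyStableSet G l h)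
    cases m with
    | zero => simp [sizeTail]
    | succ m =>
      -- The event that the first stage returns `A` depends only on edges inside `l`, so it is
      -- unchanged by toggling an edge at `v`.
      have hstep (A : Finset V) (hA : A.card = m) :
          μ.real {G | greedyStableSet G l = A ∧ ∀ u ∈ A, ¬ G.Adj u v}
            = (1 / 2) ^ m * μ.real {G | greedyStableSet G l = A} := by
        by_cases hvA : v ∈ A
        · have : {G : SimpleGraph V | greedyStableSet G l = A} = ∅ := by
            ext G
            simp only [Set.mem_ofPred_eq, Set.mem_empty_iff_false, iff_false]
            rintro rfl
            exact hvg G hvA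
          rw [this, Set.ofPred_and, this]
          simp
        · rw [← hA]
          refine binomialRandom_inter_forall_not_adj (E := {G | greedyStableSet G l = A}) A hvA
            fun u _ G => ?_
          rw [Set.mem_ofPred_eq, Set.mem_ofPred_eq]
          rw [greedyStableSet_congr (G' := G) l]
          intro x hx y hy
          have hxv : x ≠ v := fun h => hvl (h ▸ hx)
          have hyv : y ≠ v := fun h => hvl (h ▸ hy)
          simp [symmDiff_def, SimpleGraph.edge_adj, hxv, hyv]
      have hsum : μ.real {G | (greedyStableSet G l).card = m ∧
            ∀ u ∈ greedyStableSet G l, ¬ G.Adj u v}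
          = (1 / 2) ^ m * μ.real {G | (greedyStableSet G l).card = m} := by
        have e1 : {G : SimpleGraph V | (greedyStableSet G l).card = m ∧
            ∀ u ∈ greedyStableSet G l, ¬ G.Adj u v} =
            ⋃ A ∈ (Finset.univ.filter fun A : Finset V => A.card = m),
              {G | greedyStableSet G l = A ∧ ∀ u ∈ A, ¬ G.Adj u v} := by
          ext G; simp
        have e2 : {G : SimpleGraph V | (greedyStableSet G l).card = m} =
            ⋃ A ∈ (Finset.univ.filter fun A : Finset V => A.card = m),
              {G | greedyStableSet G l = A} := by
          ext G; simp
        rw [e1, e2, measureReal_biUnion_finset, measureReal_biUnion_finset, Finset.mul_sum]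
        · exact Finset.sum_congr rfl fun A hA => hstep A (Finset.mem_filter.1 hA).2
        · intro A _ B _ hAB
          exact Set.disjoint_left.2 fun G h1 h2 => hAB (h1.symm.trans h2)
        · exact fun _ _ => measurableSet_simpleGraph _
        · intro A _ B _ hAB
          exact Set.disjoint_left.2 fun G h1 h2 => hAB (h1.1.symm.trans h2.1)
        · exact fun _ _ => measurableSet_simpleGraph _
      have hlevel : μ.real {G | (greedyStableSet G l).card = m}
          = sizeTail m l.length - sizeTail (m + 1) l.length := by
        rw [← ih m, ← ih (m + 1), ← measureReal_sdiff _ (measurableSet_simpleGraph _)]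
        · congr 1
          ext G
          simp
          omega
        · intro G (hG : m + 1 ≤ _)
          exact Nat.le_of_succ_le hG
      have hunion : {G : SimpleGraph V | m + 1 ≤ (greedyStableSet G (l ++ [v])).card}
          = {G | m + 1 ≤ (greedyStableSet G l).card} ∪
            {G | (greedyStableSet G l).card = m ∧
              ∀ u ∈ greedyStableSet G l, ¬ G.Adj u v} := by
        ext G
        simp only [Set.mem_ofPred_eq, Set.mem_union, greedyStableSet_append_singleton]
        split_ifs with h
        · rw [Finset.card_insert_of_notMem (hvg G)]
          exact ⟨fun hh => (Nat.lt_or_ge m _).imp id fun h' => ⟨by omega, h⟩,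
            fun hh => hh.elim (by omega) fun h' => by omega⟩
        · simp [h]
      rw [hunion, measureReal_union _ (measurableSet_simpleGraph _), ih, hsum, hlevel,
        List.length_append, List.length_singleton, sizeTail]
      · ring
      · refine Set.disjoint_left.2 fun G (h1 : m + 1 ≤ _) h2 => ?_
        have := h2.1
        omega

end Greedy

theorem graphOrderMeasure_le_greedySize (n m : ℕ) :
    (graphOrderMeasure n).real {x | m ≤ greedySize n x} = sizeTail m n := by
  have hprob : IsProbabilityMeasure (uniformOn (Set.univ : Set (Equiv.Perm (Fin n)))) :=
    isProbabilityMeasure_uniformOn Set.finite_univ Set.univ_nonempty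
  have hmeas : MeasurableSet {x | m ≤ greedySize n x} :=
    measurable_greedySize n measurableSet_Ici
  have hσ (σ : Equiv.Perm (Fin n)) : SimpleGraph.binomialRandom (Fin n) oneHalf
      {G | m ≤ (greedyStableSet G (scanOrder σ)).card} = ENNReal.ofReal (sizeTail m n) := by
    have h := binomialRandom_le_card_greedyStableSet (scanOrder σ)
      (List.nodup_ofFn.2 σ.injective) m
    rw [scanOrder, List.length_ofFn] at h
    rw [← h, measureReal_def, ENNReal.ofReal_toReal (measure_ne_top _ _)]
    rfl
  have hnn : 0 ≤ sizeTail m n := by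
    have h := binomialRandom_le_card_greedyStableSet (scanOrder (1 : Equiv.Perm (Fin n)))
      (List.nodup_ofFn.2 (Equiv.injective _)) m
    rw [scanOrder, List.length_ofFn] at h
    rw [← h]
    exact measureReal_nonneg
  rw [measureReal_def, graphOrderMeasure, Measure.prod_apply_symm hmeas]
  have : ∀ σ : Equiv.Perm (Fin n), SimpleGraph.binomialRandom (Fin n) oneHalf
      ((fun G => (G, σ)) ⁻¹' {x | m ≤ greedySize n x}) = ENNReal.ofReal (sizeTail m n) := hσ
  simp only [this, lintegral_const, measure_univ, mul_one]
  exact ENNReal.toReal_ofReal hnn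

/-! ### Sums of geometric random variables -/

/-- Unrolling the recursion in `t` gives a convolution with the waiting time `k + 1` for the last
acceptance. -/
theorem sizeTail_succ_eq_sum (m t : ℕ) :
    sizeTail (m + 1) t = ∑ k ∈ Finset.range t,
      (1 / 2) ^ m * (1 - (1 / 2) ^ m) ^ k * sizeTail m (t - 1 - k) := by
  induction t with
  | zero => simp [sizeTail]
  | succ t ih =>
    rw [Finset.sum_range_succ', sizeTail, ih, Finset.mul_sum]
    congr 1
    · refine Finset.sum_congr rfl fun k _ => ?_
      rw [show t + 1 - 1 - (k + 1) = t - 1 - k by omega]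
      ring
    · simp

theorem measureReal_sum_geometric_le {Ω : Type*} [MeasurableSpace Ω] {μ : Measure Ω}
    [IsProbabilityMeasure μ] {Y : ℕ → Ω → ℕ} (hY : ∀ i, Measurable (Y i))
    (hind : iIndepFun Y μ) (hpos : ∀ i ω, 1 ≤ Y i ω)
    (hlaw : ∀ i k, μ.real {ω | Y i ω ≤ k} = 1 - (1 - (1 / 2) ^ i) ^ k) (m t : ℕ) :
    μ.real {ω | ∑ i ∈ Finset.range m, Y i ω ≤ t} = sizeTail m t := by
  induction m generalizing t with
  | zero => simp [sizeTail]
  | succ m ih =>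
    have hS : Measurable (∑ i ∈ Finset.range m, Y i) := by fun_prop
    have hind' : IndepFun (∑ i ∈ Finset.range m, Y i) (Y m) μ :=
      hind.indepFun_finsetSum_of_notMem hY (by simp)
    have hpt (k : ℕ) : μ.real {ω | Y m ω = k + 1} = (1 / 2) ^ m * (1 - (1 / 2) ^ m) ^ k := by
      have h : {ω | Y m ω = k + 1} = {ω | Y m ω ≤ k + 1} \ {ω | Y m ω ≤ k} := by
        ext ω; simp; omega
      have hk : MeasurableSet {ω | Y m ω ≤ k} := hY m measurableSet_Iic
      rw [h, measureReal_sdiff _ hk, hlaw, hlaw]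
      · ring
      · intro ω (hω : _ ≤ k)
        exact hω.trans (Nat.le_succ k)
    have hU : {ω | ∑ i ∈ Finset.range (m + 1), Y i ω ≤ t} = ⋃ k ∈ Finset.range t,
        ((∑ i ∈ Finset.range m, Y i) ⁻¹' Set.Iic (t - 1 - k) ∩ Y m ⁻¹' {k + 1}) := by
      ext ω
      simp only [Finset.sum_range_succ, Set.mem_ofPred_eq, Set.mem_iUnion, Set.mem_inter_iff,
        Set.mem_preimage, Finset.sum_apply, Set.mem_Iic, Set.mem_singleton_iff,
        Finset.mem_range, exists_prop]
      have := hpos m ω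
      constructor
      · intro h
        exact ⟨Y m ω - 1, by omega, by omega, by omega⟩
      · rintro ⟨k, h1, h2, h3⟩
        omega
    rw [hU, measureReal_biUnion_finset, sizeTail_succ_eq_sum]
    · refine Finset.sum_congr rfl fun k _ => ?_
      rw [measureReal_def, hind'.measure_inter_preimage_eq_mul _ _ measurableSet_Iic
        (measurableSet_singleton _), ENNReal.toReal_mul, ← measureReal_def, ← measureReal_def,
        mul_comm]
      congr 1
      · exact hpt k
      · rw [← ih]
        congr 1
        ext ω
        simp
    · intro k _ l _ hkl
      refine Set.disjoint_left.2 fun ω h1 h2 => hkl ?_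
      have e1 : Y m ω = k + 1 := h1.2
      have e2 : Y m ω = l + 1 := h2.2
      omega
    · exact fun k _ => (hS measurableSet_Iic).inter (hY m (measurableSet_singleton _))

/-! ### Exponential random variables -/

theorem expMeasure_le_mul_volume {r : ℝ} (hr : 0 < r) {s : Set ℝ} (hs : MeasurableSet s) :
    expMeasure r s ≤ ENNReal.ofReal r * volume s := by
  rw [expMeasure, gammaMeasure, withDensity_apply _ hs]
  calc ∫⁻ x in s, gammaPDF 1 r x ≤ ∫⁻ _ in s, ENNReal.ofReal r := by
        refine lintegral_mono fun x => ?_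
        change exponentialPDF r x ≤ _
        rw [exponentialPDF_eq]
        refine ENNReal.ofReal_le_ofReal ?_
        split_ifs with h
        · exact mul_le_of_le_one_right hr.le (Real.exp_le_one_iff.2 (by nlinarith))
        · exact hr.le
    _ = _ := by rw [setLIntegral_const]

/-- The open half-line is what rounding down produces: `⌊y⌋ < k` means `y < k`. -/
theorem expMeasure_real_Iio {r x : ℝ} (hr : 0 < r) (hx : 0 ≤ x) :
    (expMeasure r).real (Set.Iio x) = 1 - Real.exp (-(r * x)) := by
  have := isProbabilityMeasure_expMeasure hr
  have h0 : expMeasure r {x} = 0 :=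
    le_antisymm ((expMeasure_le_mul_volume hr (measurableSet_singleton x)).trans (by simp))
      zero_le
  have h1 : (expMeasure r).real (Set.Iio x) = (expMeasure r).real (Set.Iic x) := by
    rw [← Set.Iic_sdiff_right, measureReal_def, measureReal_def, measure_sdiff_null h0]
  rw [h1, ← cdf_eq_real, cdf_expMeasure_eq hr, if_pos hx]

theorem expMeasure_Iio_zero {r : ℝ} (hr : 0 < r) : expMeasure r (Set.Iio 0) = 0 := by
  have := isProbabilityMeasure_expMeasure hr
  have h := expMeasure_real_Iio hr le_rfl
  rw [measureReal_def] at h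
  simpa [ENNReal.toReal_eq_zero_iff, measure_ne_top] using h

/-- Adding an independent random variable to an exponential one keeps the density bound. -/
theorem measure_add_mem_Ioc_le {Ω : Type*} [MeasurableSpace Ω] {μ : Measure Ω}
    [IsProbabilityMeasure μ] {X R : Ω → ℝ} (hX : Measurable X) (hR : Measurable R)
    (hind : IndepFun X R μ) {r : ℝ} (hr : 0 < r) (hlaw : μ.map X = expMeasure r) (x y : ℝ) :
    μ {ω | X ω + R ω ∈ Set.Ioc x y} ≤ ENNReal.ofReal (r * (y - x)) := by
  have hprob := isProbabilityMeasure_expMeasure hr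
  have : IsProbabilityMeasure (μ.map R) := Measure.isProbabilityMeasure_map hR.aemeasurable
  have hm : MeasurableSet {z : ℝ × ℝ | z.1 + z.2 ∈ Set.Ioc x y} :=
    (measurable_fst.add measurable_snd) measurableSet_Ioc
  have h1 : μ {ω | X ω + R ω ∈ Set.Ioc x y}
      = (μ.map fun ω => (X ω, R ω)) {z : ℝ × ℝ | z.1 + z.2 ∈ Set.Ioc x y} := by
    rw [Measure.map_apply (hX.prodMk hR) hm]
    rfl
  rw [h1, hind.map_prod_eq_prod_map_map hX.aemeasurable hR.aemeasurable, hlaw,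
    Measure.prod_apply_symm hm]
  calc _ ≤ ∫⁻ _, ENNReal.ofReal (r * (y - x)) ∂(μ.map R) := by
        refine lintegral_mono fun z => ?_
        have e : (fun w => (w, z)) ⁻¹' {z : ℝ × ℝ | z.1 + z.2 ∈ Set.Ioc x y}
            = Set.Ioc (x - z) (y - z) := by
          ext w
          simp only [Set.mem_preimage, Set.mem_ofPred_eq, Set.mem_Ioc]
          constructor <;> rintro ⟨_, _⟩ <;> constructor <;> linarith
        change expMeasure r ((fun w => (w, z)) ⁻¹' _) ≤ _
        rw [e]
        refine (expMeasure_le_mul_volume hr measurableSet_Ioc).trans_eq ?_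
        rw [Real.volume_Ioc, ← ENNReal.ofReal_mul hr.le]
        congr 2
        ring
    _ = _ := by simp

theorem map_eval_expSeqMeasure (i : ℕ) :
    expSeqMeasure.map (fun ω => ω i) = expMeasure (2 ^ (i + 1)) :=
  (measurePreserving_eval_infinitePi (fun i : ℕ => expMeasure ((2 : ℝ) ^ (i + 1))) i).map_eq

theorem expSeqMeasure_real_eval (i : ℕ) {s : Set ℝ} (hs : MeasurableSet s) :
    expSeqMeasure.real {ω | ω i ∈ s} = (expMeasure (2 ^ (i + 1))).real s := by
  rw [← map_eval_expSeqMeasure, measureReal_def, measureReal_def,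
    Measure.map_apply (measurable_pi_apply i) hs]
  rfl

theorem ae_nonneg_expSeq : ∀ᵐ ω ∂expSeqMeasure, ∀ i, 0 ≤ ω i := by
  rw [ae_all_iff]
  intro i
  have h := expMeasure_Iio_zero (r := 2 ^ (i + 1)) (by positivity)
  rw [← map_eval_expSeqMeasure, Measure.map_apply (measurable_pi_apply i) measurableSet_Iio] at h
  rw [ae_iff]
  simpa [Set.preimage] using h

theorem iIndepFun_eval_expSeqMeasure :
    iIndepFun (fun (i : ℕ) (ω : ℕ → ℝ) => ω i) expSeqMeasure :=
  iIndepFun_infinitePi (X := fun _ x => x) fun _ => measurable_id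

theorem measurable_toReal_tsum_ofReal {Ω : Type*} [MeasurableSpace Ω] {f : ℕ → Ω → ℝ}
    (hf : ∀ j, Measurable (f j)) : Measurable fun ω => (∑' j, ENNReal.ofReal (f j ω)).toReal :=
  Measurable.ennreal_toReal (Measurable.tsum fun j => (hf j).ennreal_ofReal)

/-- Summing in `ENNReal` makes the remainder measurable everywhere with respect to the coordinates
of index at least `1`, with no appeal to almost sure convergence. -/
theorem indepFun_eval_zero_tail : IndepFun (fun ω : ℕ → ℝ => ω 0)
    (fun ω => (∑' j, ENNReal.ofReal (ω (j + 1))).toReal) expSeqMeasure := by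
  have h := indep_iSup_of_disjoint (S := {0}) (T := {0}ᶜ)
    (m := fun i : ℕ => MeasurableSpace.comap (fun ω : ℕ → ℝ => ω i) inferInstance)
    (fun i => (measurable_pi_apply i).comap_le)
    iIndepFun_eval_expSeqMeasure disjoint_compl_right
  refine indep_of_indep_of_le_left (indep_of_indep_of_le_right h ?_) ?_
  · rw [← measurable_iff_comap_le]
    refine @measurable_toReal_tsum_ofReal _ (_) (fun j (ω : ℕ → ℝ) => ω (j + 1)) fun j => ?_
    rw [measurable_iff_comap_le]
    exact le_iSup₂_of_le (j + 1) (by simp) le_rfl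
  · exact le_iSup₂_of_le 0 (by simp) le_rfl

/-- The first exponential has rate `2`, hence density at most `2`, and adding the independent
remainder keeps this bound. -/
theorem hypo_mem_Ioc_le (x y : ℝ) :
    expSeqMeasure {ω | hypo ω ∈ Set.Ioc x y} ≤ ENNReal.ofReal (2 * (y - x)) := by
  have h := measure_add_mem_Ioc_le (measurable_pi_apply 0)
    (measurable_toReal_tsum_ofReal fun j => measurable_pi_apply (j + 1))
    indepFun_eval_zero_tail (by positivity) (map_eval_expSeqMeasure 0) x y
  refine le_trans (measure_mono_ae ?_) (h.trans_eq (by norm_num))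
  filter_upwards [ae_nonneg_expSeq, ae_summable_expSeq] with ω h0 hs hω
  have hs' : Summable fun j => ω (j + 1) := (summable_nat_add_iff 1).2 hs
  have e : (∑' j, ENNReal.ofReal (ω (j + 1))).toReal = ∑' j, ω (j + 1) := by
    rw [← ENNReal.ofReal_tsum_of_nonneg (fun j => h0 (j + 1)) hs',
      ENNReal.toReal_ofReal (tsum_nonneg fun j => h0 (j + 1))]
  change ω 0 + (∑' j, ENNReal.ofReal (ω (j + 1))).toReal ∈ Set.Ioc x y
  rw [e, ← hs.tsum_eq_zero_add]
  exact hω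

theorem ae_hypo_pos : ∀ᵐ ω ∂expSeqMeasure, 0 < hypo ω := by
  have h : expSeqMeasure {ω | ω 0 ∈ Set.Iic 0} = 0 := by
    have h1 := expMeasure_le_mul_volume (r := 2 ^ (0 + 1)) (by positivity)
      (measurableSet_singleton (0 : ℝ))
    have h2 := expMeasure_Iio_zero (r := 2 ^ (0 + 1)) (by positivity)
    have h3 : expMeasure (2 ^ (0 + 1)) (Set.Iic 0) = 0 := by
      rw [← Set.Iio_union_right]
      exact measure_union_null h2 (le_antisymm (h1.trans (by simp)) zero_le)
    rwa [← map_eval_expSeqMeasure, Measure.map_apply (measurable_pi_apply 0)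
      measurableSet_Iic] at h3
  have h' : ∀ᵐ ω ∂expSeqMeasure, ω 0 ∉ Set.Iic 0 := measure_eq_zero_iff_ae_notMem.1 h
  filter_upwards [h', ae_nonneg_expSeq, ae_summable_expSeq] with ω h1 h0 hs
  exact (not_le.1 h1).trans_le (hs.le_tsum 0 fun j _ => h0 j)

/-! ### Moments -/

theorem lintegral_mul_abs_eval_le {c : ℝ} (hc : 0 ≤ c) (j : ℕ) :
    ∫⁻ ω, ENNReal.ofReal (c * |ω j|) ∂expSeqMeasure ≤ ENNReal.ofReal (c * (1 / 2) ^ (j + 1)) := by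
  have h := lintegral_expMeasure_le (r := 2 ^ (j + 1)) (by positivity)
  rw [← map_eval_expSeqMeasure, lintegral_map (by fun_prop) (measurable_pi_apply j)] at h
  simp_rw [ENNReal.ofReal_mul hc]
  rw [lintegral_const_mul _ (by fun_prop), one_div_pow]
  gcongr

theorem tsum_ofReal_mul_pow {c : ℝ} (hc : 0 ≤ c) :
    ∑' j : ℕ, ENNReal.ofReal (c * (1 / 2) ^ (j + 1)) = ENNReal.ofReal c := by
  rw [← ENNReal.ofReal_tsum_of_nonneg (fun j => by positivity)
    (((summable_nat_add_iff 1).2 summable_geometric_two).mul_left c), tsum_mul_left]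
  have h : ∑' j : ℕ, ((1 : ℝ) / 2) ^ (j + 1) = 1 := by
    simp_rw [pow_succ']
    rw [tsum_mul_left, tsum_geometric_two]
    norm_num
  rw [h, mul_one]

theorem lintegral_tsum_mul_abs_le {c : ℝ} (hc : 0 ≤ c) (m : ℕ) :
    ∫⁻ ω, ∑' j, ENNReal.ofReal (c * |ω (j + m)|) ∂expSeqMeasure
      ≤ ENNReal.ofReal (c * (1 / 2) ^ m) := by
  rw [lintegral_tsum fun j => Measurable.aemeasurable (by fun_prop), ← tsum_ofReal_mul_pow (by positivity)]
  refine ENNReal.tsum_le_tsum fun j => (lintegral_mul_abs_eval_le hc (j + m)).trans_eq ?_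
  congr 1
  ring

/-- Markov's inequality for the limit variable. -/
theorem expSeqMeasure_lt_hypo_le {a : ℝ} (ha : 0 < a) :
    expSeqMeasure.real {ω | a < hypo ω} ≤ 1 / a := by
  have h1 := lintegral_tsum_mul_abs_le zero_le_one 0
  rw [pow_zero, mul_one, ENNReal.ofReal_one] at h1
  have h2 : expSeqMeasure {ω | a < hypo ω} ≤ 1 / ENNReal.ofReal a := by
    refine le_trans (measure_mono_ae ?_) ((meas_ge_le_lintegral_div
      (f := fun ω : ℕ → ℝ => ∑' j, ENNReal.ofReal (1 * |ω (j + 0)|))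
      (Measurable.tsum fun j => by fun_prop).aemeasurable
      (ENNReal.ofReal_pos.2 ha).ne' ENNReal.ofReal_ne_top).trans
      (ENNReal.div_le_div_right h1 _))
    filter_upwards [ae_nonneg_expSeq, ae_summable_expSeq] with ω h0 hs (hω : a < hypo ω)
    change ENNReal.ofReal a ≤ ∑' j, ENNReal.ofReal (1 * |ω (j + 0)|)
    simp_rw [one_mul, add_zero, abs_of_nonneg (h0 _)]
    rw [← ENNReal.ofReal_tsum_of_nonneg h0 hs]
    exact ENNReal.ofReal_le_ofReal hω.le
  refine ENNReal.toReal_le_of_le_ofReal (by positivity) (h2.trans_eq ?_)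
  rw [ENNReal.ofReal_div_of_pos ha, ENNReal.ofReal_one]

theorem hypo_mem_Ioc_real_le {x y : ℝ} (hxy : x ≤ y) :
    expSeqMeasure.real {ω | hypo ω ∈ Set.Ioc x y} ≤ 2 * (y - x) :=
  ENNReal.toReal_le_of_le_ofReal (by linarith) (hypo_mem_Ioc_le x y)

/-- Bound for the deviation of the rescaled limit variable from a sum of geometric variables. -/
def deviation (m : ℕ) (ω : ℕ → ℝ) : ℝ :=
  ∑ j ∈ Finset.range m, 2 ^ (j + 1) * ω j + 2 ^ m * ∑' j, ω (j + m)

/-- Markov's inequality: each `2 ^ (j + 1) * ω j` has mean at most `1`, and so has the rescaled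
remainder. -/
theorem expSeqMeasure_le_deviation_le (m : ℕ) {c : ℝ} (hc : 0 < c) :
    expSeqMeasure.real {ω | c ≤ deviation m ω} ≤ (m + 1) / c := by
  set D : (ℕ → ℝ) → ENNReal := fun ω =>
    ∑ j ∈ Finset.range m, ENNReal.ofReal (2 ^ (j + 1) * |ω j|) +
      ∑' j, ENNReal.ofReal (2 ^ m * |ω (j + m)|) with hD
  have hDm : Measurable D := by
    refine Measurable.add (by fun_prop) (Measurable.tsum fun j => by fun_prop)
  have h1 : ∫⁻ ω, D ω ∂expSeqMeasure ≤ ENNReal.ofReal (m + 1) := by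
    rw [hD, lintegral_add_left (by fun_prop), lintegral_finsetSum _ fun j _ => by fun_prop,
      ENNReal.ofReal_add (by positivity) zero_le_one]
    refine add_le_add ?_ ?_
    · have (j : ℕ) : ∫⁻ ω, ENNReal.ofReal (2 ^ (j + 1) * |ω j|) ∂expSeqMeasure ≤ 1 := by
        refine (lintegral_mul_abs_eval_le (by positivity) j).trans_eq ?_
        rw [← mul_pow]
        norm_num
      refine (Finset.sum_le_sum fun j _ => this j).trans_eq ?_
      simp
    · refine (lintegral_tsum_mul_abs_le (by positivity) m).trans_eq ?_
      rw [← mul_pow]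
      norm_num
  have h2 : expSeqMeasure {ω | c ≤ deviation m ω} ≤ ENNReal.ofReal (m + 1) / ENNReal.ofReal c := by
    refine le_trans (measure_mono_ae ?_) ((meas_ge_le_lintegral_div hDm.aemeasurable
      (ENNReal.ofReal_pos.2 hc).ne' ENNReal.ofReal_ne_top).trans
      (ENNReal.div_le_div_right h1 _))
    filter_upwards [ae_nonneg_expSeq, ae_summable_expSeq] with ω h0 hs (hω : c ≤ deviation m ω)
    change ENNReal.ofReal c ≤ D ω
    simp_rw [hD, abs_of_nonneg (h0 _)]
    rw [← ENNReal.ofReal_tsum_of_nonneg (fun j => mul_nonneg (by positivity) (h0 _))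
      (((summable_nat_add_iff m).2 hs).mul_left _), ← ENNReal.ofReal_sum_of_nonneg
      (fun j _ => mul_nonneg (by positivity) (h0 _)), ← ENNReal.ofReal_add
      (Finset.sum_nonneg fun j _ => mul_nonneg (by positivity) (h0 _))
      (tsum_nonneg fun j => mul_nonneg (by positivity) (h0 _)), tsum_mul_left]
    exact ENNReal.ofReal_le_ofReal hω
  refine ENNReal.toReal_le_of_le_ofReal (by positivity) (h2.trans_eq ?_)
  rw [ENNReal.ofReal_div_of_pos hc]

/-! ### Geometric variables as rounded exponential ones -/

/-- The rate `λ` with `exp (-λ) = 1 - 2 ^ (-i)`; junk value `0` at `i = 0`. -/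
def geomRate (i : ℕ) : ℝ := -Real.log (1 - (1 / 2) ^ i)

theorem geomRate_pos {i : ℕ} (hi : i ≠ 0) : 0 < geomRate i := by
  have h : (1 / 2 : ℝ) ^ i < 1 := pow_lt_one₀ (by norm_num) (by norm_num) hi
  have h' : (0 : ℝ) < (1 / 2) ^ i := by positivity
  exact neg_pos.2 (Real.log_neg (by linarith) (by linarith))

theorem geomRate_zero : geomRate 0 = 0 := by simp [geomRate]

/-- With `p = 2 ^ (-i)`, the bounds `1 - 1 / x ≤ log x ≤ x - 1` at `x = 1 - p` give `p ≤ geomRate i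
≤ p / (1 - p)`. At `i = 0` the convention `0⁻¹ = 0` fits. -/
theorem inv_geomRate_mem (i : ℕ) : 2 ^ i - 1 ≤ (geomRate i)⁻¹ ∧ (geomRate i)⁻¹ ≤ 2 ^ i := by
  rcases eq_or_ne i 0 with rfl | hi
  · simp [geomRate_zero]
  have hp : (1 / 2 : ℝ) ^ i < 1 := pow_lt_one₀ (by norm_num) (by norm_num) hi
  have hp' : (0 : ℝ) < (1 / 2) ^ i := by positivity
  have h2 : (2 : ℝ) ^ i = ((1 / 2) ^ i)⁻¹ := by simp
  have hpos := geomRate_pos hi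
  rw [h2]
  constructor
  · have h := Real.one_sub_inv_le_log_of_pos (x := 1 - (1 / 2) ^ i) (by linarith)
    have h3 : geomRate i ≤ (1 - (1 / 2) ^ i)⁻¹ - 1 := by unfold geomRate; linarith
    have h4 : (((1 / 2 : ℝ) ^ i)⁻¹ - 1) = ((1 - (1 / 2 : ℝ) ^ i)⁻¹ - 1)⁻¹ := by
      have : 1 - (1 / 2 : ℝ) ^ i ≠ 0 := by linarith
      generalize (1 / 2 : ℝ) ^ i = p at *
      have e : (1 - p)⁻¹ - 1 = p / (1 - p) := by field_simp; ring
      rw [e, inv_div]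
      field_simp
    rw [h4]
    exact inv_anti₀ hpos h3
  · refine inv_anti₀ hp' ?_
    have := Real.log_le_sub_one_of_pos (x := 1 - (1 / 2) ^ i) (by linarith)
    unfold geomRate
    linarith

/-- The geometric variable with success probability `2 ^ (-i)` obtained by rounding the `j`-th
exponential variable. -/
def geomOfExp (i j : ℕ) (x : ℝ) : ℕ := ⌊2 ^ (j + 1) * x * (geomRate i)⁻¹⌋₊ + 1

theorem measurable_geomOfExp (i j : ℕ) : Measurable (geomOfExp i j) := by
  unfold geomOfExp
  fun_prop

theorem expSeqMeasure_geomOfExp_le (i j k : ℕ) :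
    expSeqMeasure.real {ω | geomOfExp i j (ω j) ≤ k} = 1 - (1 - (1 / 2) ^ i) ^ k := by
  rcases Nat.eq_zero_or_pos k with rfl | hk
  · simp [geomOfExp]
  rcases eq_or_ne i 0 with rfl | hi
  -- Since `(geomRate 0)⁻¹ = 0`, the variable is constantly `1`, as it must be for success
  -- probability `1`.
  · have : {ω : ℕ → ℝ | geomOfExp 0 j (ω j) ≤ k} = Set.univ := by
      ext ω
      simp [geomOfExp, geomRate_zero]
      omega
    rw [this]
    simp [hk.ne']
  have hp : (1 / 2 : ℝ) ^ i < 1 := pow_lt_one₀ (by norm_num) (by norm_num) hi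
  have hpos := geomRate_pos hi
  have h : {ω : ℕ → ℝ | geomOfExp i j (ω j) ≤ k}
      = {ω | ω j ∈ Set.Iio (k * geomRate i / 2 ^ (j + 1))} := by
    ext ω
    rw [Set.mem_ofPred_eq, geomOfExp, Nat.succ_le_iff, Nat.floor_lt' hk.ne', Set.mem_ofPred_eq,
      Set.mem_Iio, lt_div_iff₀ (by positivity), ← div_eq_mul_inv, div_lt_iff₀ hpos, mul_comm (ω j)]
  rw [h, expSeqMeasure_real_eval j measurableSet_Iio,
    expMeasure_real_Iio (by positivity) (by positivity)]
  congr 1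
  rw [mul_div_cancel₀ _ (by positivity), geomRate, mul_neg, neg_neg, ← Real.log_pow,
    Real.exp_log (pow_pos (by linarith) _)]

theorem geomOfExp_le {i j : ℕ} {x : ℝ} (hx : 0 ≤ x) :
    (geomOfExp i j x : ℝ) ≤ 2 ^ (i + j + 1) * x + 1 := by
  have h := (inv_geomRate_mem i).2
  have h0 : 0 ≤ (geomRate i)⁻¹ := by
    rcases eq_or_ne i 0 with rfl | hi
    · simp [geomRate_zero]
    · exact (inv_pos.2 (geomRate_pos hi)).le
  unfold geomOfExp
  push_cast
  have h1 := Nat.floor_le (a := 2 ^ (j + 1) * x * (geomRate i)⁻¹) (by positivity)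
  have h2 : 2 ^ (j + 1) * x * (geomRate i)⁻¹ ≤ 2 ^ (j + 1) * x * 2 ^ i := by gcongr
  have h3 : (2 : ℝ) ^ (j + 1) * x * 2 ^ i = 2 ^ (i + j + 1) * x := by ring
  linarith

theorem le_geomOfExp {i j : ℕ} {x : ℝ} (hx : 0 ≤ x) :
    2 ^ (i + j + 1) * x - 2 ^ (j + 1) * x ≤ (geomOfExp i j x : ℝ) := by
  have h := (inv_geomRate_mem i).1
  unfold geomOfExp
  push_cast
  have h1 := Nat.lt_floor_add_one (2 ^ (j + 1) * x * (geomRate i)⁻¹)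
  have h2 : 2 ^ (j + 1) * x * (2 ^ i - 1) ≤ 2 ^ (j + 1) * x * (geomRate i)⁻¹ := by gcongr
  have h3 : (2 : ℝ) ^ (j + 1) * x * (2 ^ i - 1) = 2 ^ (i + j + 1) * x - 2 ^ (j + 1) * x := by ring
  linarith

/-- A sum of independent geometric variables with success probabilities `1, 1/2, …, 2 ^ (1 - m)`,
coupled to the exponential variables. -/
def geomSum (m : ℕ) (ω : ℕ → ℝ) : ℕ :=
  ∑ j ∈ Finset.range m, geomOfExp (m - 1 - j) j (ω j)

theorem expSeqMeasure_geomSum_le (m t : ℕ) :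
    expSeqMeasure.real {ω | geomSum m ω ≤ t} = sizeTail m t := by
  -- The reversal of `range m`, extended by the identity to an injection of `ℕ` so that independence
  -- passes to the reindexed family.
  set e : ℕ → ℕ := fun i => if i < m then m - 1 - i else i with he
  have hinj : Function.Injective e := by
    intro a b hab
    simp only [he] at hab
    split_ifs at hab <;> omega
  have h := measureReal_sum_geometric_le (μ := expSeqMeasure)
    (Y := fun i ω => geomOfExp i (e i) (ω (e i)))
    (fun i => (measurable_geomOfExp i (e i)).comp (measurable_pi_apply _))
    ((iIndepFun_eval_expSeqMeasure.precomp hinj).comp _ fun i => measurable_geomOfExp i (e i))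
    (fun i ω => by simp [geomOfExp])
    (fun i k => expSeqMeasure_geomOfExp_le i (e i) k) m t
  rw [← h]
  congr 1
  ext ω
  rw [Set.mem_ofPred_eq, Set.mem_ofPred_eq, geomSum,
    ← Finset.sum_range_reflect (fun j => geomOfExp (m - 1 - j) j (ω j)) m]
  have : ∀ i ∈ Finset.range m, geomOfExp (m - 1 - (m - 1 - i)) (m - 1 - i) (ω (m - 1 - i))
      = geomOfExp i (e i) (ω (e i)) := by
    intro i hi
    rw [Finset.mem_range] at hi
    simp only [he, if_pos hi]
    rw [show m - 1 - (m - 1 - i) = i by omega]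
  rw [Finset.sum_congr rfl this]

/-- Each of the `m` roundings adds at most `1`. -/
theorem geomSum_le {m : ℕ} {ω : ℕ → ℝ} (h0 : ∀ i, 0 ≤ ω i) (hs : Summable ω) :
    (geomSum m ω : ℝ) ≤ 2 ^ m * hypo ω + m := by
  have h1 : (geomSum m ω : ℝ) ≤ ∑ j ∈ Finset.range m, (2 ^ m * ω j + 1) := by
    rw [geomSum, Nat.cast_sum]
    refine Finset.sum_le_sum fun j hj => (geomOfExp_le (h0 j)).trans_eq ?_
    rw [Finset.mem_range] at hj
    rw [show m - 1 - j + j + 1 = m by omega]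
  rw [Finset.sum_add_distrib, ← Finset.mul_sum] at h1
  simp only [Finset.sum_const, Finset.card_range, nsmul_eq_mul, mul_one] at h1
  have h2 : ∑ j ∈ Finset.range m, ω j ≤ hypo ω := hs.sum_le_tsum _ fun j _ => h0 j
  have h3 : (2 : ℝ) ^ m * ∑ j ∈ Finset.range m, ω j ≤ 2 ^ m * hypo ω := by gcongr
  linarith

/-- Rounding loses nothing here. Replacing `2 ^ i` by `2 ^ i - 1` costs `2 ^ (j + 1) * ω j` in each
term, and omitting the indices `j ≥ m` costs the rest of `deviation`. -/
theorem le_geomSum {m : ℕ} {ω : ℕ → ℝ} (h0 : ∀ i, 0 ≤ ω i) (hs : Summable ω) :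
    2 ^ m * hypo ω - deviation m ω ≤ geomSum m ω := by
  have h1 : ∑ j ∈ Finset.range m, (2 ^ m * ω j - 2 ^ (j + 1) * ω j) ≤ (geomSum m ω : ℝ) := by
    rw [geomSum, Nat.cast_sum]
    refine Finset.sum_le_sum fun j hj => le_of_eq_of_le ?_ (le_geomOfExp (h0 j))
    rw [Finset.mem_range] at hj
    rw [show m - 1 - j + j + 1 = m by omega]
  rw [Finset.sum_sub_distrib, ← Finset.mul_sum] at h1
  have h2 : hypo ω = ∑ j ∈ Finset.range m, ω j + ∑' j, ω (j + m) :=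
    (hs.sum_add_tsum_nat_add m).symm
  rw [h2, deviation]
  linarith

/-! ### Comparison of the tails -/

/-- The events `geomSum m ≤ n` and `2 ^ m * H ≤ n` differ only if `2 ^ m * H` lies within `m` below
or `c` above `n`, or if the deviation is at least `c`. -/
theorem abs_sizeTail_sub_le (m n : ℕ) {c : ℝ} (hc : 0 < c) :
    |sizeTail m n - expSeqMeasure.real {ω | 2 ^ m * hypo ω ≤ n}|
      ≤ 2 * (m + c) / 2 ^ m + (m + 1) / c := by
  rw [← expSeqMeasure_geomSum_le]
  have hwin {a b : ℝ} (hab : a ≤ b) :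
      expSeqMeasure.real {ω | 2 ^ m * hypo ω ∈ Set.Ioc a b} ≤ 2 * (b - a) / 2 ^ m := by
    have h : {ω | 2 ^ m * hypo ω ∈ Set.Ioc a b}
        = {ω | hypo ω ∈ Set.Ioc (a / 2 ^ m) (b / 2 ^ m)} := by
      ext ω
      simp only [Set.mem_ofPred_eq, Set.mem_Ioc]
      rw [div_lt_iff₀ (by positivity), le_div_iff₀ (by positivity), mul_comm]
    rw [h]
    refine (hypo_mem_Ioc_real_le (by gcongr)).trans_eq ?_
    ring
  have hmono {s t : Set (ℕ → ℝ)} (h : s ≤ᵐ[expSeqMeasure] t) :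
      expSeqMeasure.real s ≤ expSeqMeasure.real t :=
    ENNReal.toReal_mono (measure_ne_top _ _) (measure_mono_ae h)
  have hup : expSeqMeasure.real {ω | geomSum m ω ≤ n}
      ≤ expSeqMeasure.real {ω | 2 ^ m * hypo ω ≤ n} + 2 * c / 2 ^ m + (m + 1) / c := by
    have h1 : expSeqMeasure.real {ω | geomSum m ω ≤ n} ≤ expSeqMeasure.real
        ((({ω | 2 ^ m * hypo ω ≤ n} ∪ {ω | 2 ^ m * hypo ω ∈ Set.Ioc (n : ℝ) (n + c)})) ∪
          {ω | c ≤ deviation m ω}) := by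
      refine hmono ?_
      filter_upwards [ae_nonneg_expSeq, ae_summable_expSeq] with ω h0 hs (hω : geomSum m ω ≤ n)
      have h2 := le_geomSum (m := m) h0 hs
      have h3 : (geomSum m ω : ℝ) ≤ n := by exact_mod_cast hω
      by_cases hd : c ≤ deviation m ω
      · exact Or.inr hd
      by_cases hn : 2 ^ m * hypo ω ≤ n
      · exact Or.inl (Or.inl hn)
      · exact Or.inl (Or.inr ⟨not_le.1 hn, by linarith [not_le.1 hd]⟩)
    have h2 := hwin (a := n) (b := n + c) (by linarith)
    have h3 := expSeqMeasure_le_deviation_le m hc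
    have h4 := measureReal_union_le (μ := expSeqMeasure)
      ({ω | 2 ^ m * hypo ω ≤ n} ∪ {ω | 2 ^ m * hypo ω ∈ Set.Ioc (n : ℝ) (n + c)})
      {ω | c ≤ deviation m ω}
    have h5 := measureReal_union_le (μ := expSeqMeasure)
      {ω | 2 ^ m * hypo ω ≤ n} {ω | 2 ^ m * hypo ω ∈ Set.Ioc (n : ℝ) (n + c)}
    rw [add_sub_cancel_left] at h2
    linarith
  have hlow : expSeqMeasure.real {ω | 2 ^ m * hypo ω ≤ n}
      ≤ expSeqMeasure.real {ω | geomSum m ω ≤ n} + 2 * m / 2 ^ m := by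
    have h1 : expSeqMeasure.real {ω | 2 ^ m * hypo ω ≤ n} ≤ expSeqMeasure.real
        ({ω | geomSum m ω ≤ n} ∪ {ω | 2 ^ m * hypo ω ∈ Set.Ioc (n - m : ℝ) n}) := by
      refine hmono ?_
      filter_upwards [ae_nonneg_expSeq, ae_summable_expSeq] with ω h0 hs
        (hω : 2 ^ m * hypo ω ≤ n)
      have h2 := geomSum_le (m := m) h0 hs
      by_cases hn : 2 ^ m * hypo ω ≤ n - m
      · refine Or.inl ?_
        have : (geomSum m ω : ℝ) ≤ n := by linarith
        exact_mod_cast this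
      · exact Or.inr ⟨not_le.1 hn, hω⟩
    have h2 := hwin (a := n - m) (b := n) (by linarith [(Nat.cast_nonneg m : (0 : ℝ) ≤ m)])
    have h4 := measureReal_union_le (μ := expSeqMeasure)
      {ω | geomSum m ω ≤ n} {ω | 2 ^ m * hypo ω ∈ Set.Ioc (n - m : ℝ) n}
    rw [sub_sub_cancel] at h2
    linarith
  have e : 2 * (m + c) / 2 ^ m = 2 * m / 2 ^ m + 2 * c / 2 ^ m := by ring
  have hm0 : (0 : ℝ) ≤ 2 * m / 2 ^ m := by positivity
  have hc0 : (0 : ℝ) ≤ 2 * c / 2 ^ m := by positivity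
  have hd0 : (0 : ℝ) ≤ (m + 1) / c := by positivity
  rw [e, abs_le]
  constructor <;> linarith

theorem expSeqMeasure_mul_hypo_le_le {a b : ℝ} (ha : 0 < a) (hb : 0 ≤ b) :
    expSeqMeasure.real {ω | a * hypo ω ≤ b} ≤ 2 * (b / a) := by
  have h := hypo_mem_Ioc_real_le (x := 0) (y := b / a) (by positivity)
  rw [sub_zero] at h
  refine le_trans (ENNReal.toReal_mono (measure_ne_top _ _) (measure_mono_ae ?_)) h
  filter_upwards [ae_hypo_pos] with ω h0 (hω : a * hypo ω ≤ b)
  refine ⟨h0, ?_⟩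
  rwa [le_div_iff₀ ha, mul_comm]

theorem expSeqMeasure_lt_mul_hypo_le {a b : ℝ} (ha : 0 < a) (hb : 0 < b) :
    expSeqMeasure.real {ω | b < a * hypo ω} ≤ a / b := by
  have h := expSeqMeasure_lt_hypo_le (a := b / a) (by positivity)
  rw [one_div_div] at h
  have e : {ω | b < a * hypo ω} = {ω | b / a < hypo ω} := by
    ext ω
    simp only [Set.mem_ofPred_eq]
    rw [div_lt_iff₀ ha, mul_comm]
  rwa [e]

/-! ### Variation distance from tails -/

/-- Each of the `k` points of the window is a difference of two tails and costs `2 * δ`; a further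
`2 * δ` carries the bound `η` on the outside mass from `ν` to `μ`. -/
theorem tvDist_le_of_abs_tail_sub_le (μ ν : Measure ℤ) [IsProbabilityMeasure μ]
    [IsProbabilityMeasure ν] (a : ℤ) (k : ℕ) {δ η : ℝ}
    (hδ : ∀ i ≤ k, |μ.real (Set.Ici (a + i)) - ν.real (Set.Ici (a + i))| ≤ δ)
    (hη : 1 - ν.real (Set.Ici a) + ν.real (Set.Ici (a + k)) ≤ η) :
    tvDist μ ν ≤ (2 * k + 2) * δ + η := by
  have hsing (ρ : Measure ℤ) [IsProbabilityMeasure ρ] (b : ℤ) :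
      ρ.real {b} = ρ.real (Set.Ici b) - ρ.real (Set.Ici (b + 1)) := by
    rw [← measureReal_sdiff (Set.Ici_subset_Ici.2 (by omega)) measurableSet_Ici]
    congr 1
    ext x
    simp
    omega
  have hout (ρ : Measure ℤ) [IsProbabilityMeasure ρ] : ρ.real (Set.Ico a (a + k))ᶜ
      = 1 - ρ.real (Set.Ici a) + ρ.real (Set.Ici (a + k)) := by
    have h : ρ.real (Set.Ico a (a + k))
        = ρ.real (Set.Ici a) - ρ.real (Set.Ici (a + k)) := by
      rw [← measureReal_sdiff (Set.Ici_subset_Ici.2 (by omega)) measurableSet_Ici]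
      congr 1
      ext x
      simp
    rw [probReal_compl_eq_one_sub measurableSet_Ico, h]
    ring
  refine ciSup_le fun ⟨A, _⟩ => ?_
  change |μ.real A - ν.real A| ≤ _
  have hpoint (b : ℤ) (hb : |μ.real (Set.Ici b) - ν.real (Set.Ici b)| ≤ δ)
      (hb' : |μ.real (Set.Ici (b + 1)) - ν.real (Set.Ici (b + 1))| ≤ δ) :
      |μ.real (A ∩ {b}) - ν.real (A ∩ {b})| ≤ 2 * δ := by
    by_cases h : b ∈ A
    · rw [Set.inter_eq_right.2 (Set.singleton_subset_iff.2 h), hsing, hsing]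
      rw [abs_le] at *
      constructor <;> linarith
    · rw [Set.inter_singleton_eq_empty.2 h]
      have := (abs_nonneg _).trans hb
      simpa
  have hmid : ∀ j ≤ k, |μ.real (A ∩ Set.Ico a (a + j)) - ν.real (A ∩ Set.Ico a (a + j))|
      ≤ 2 * j * δ := by
    intro j
    induction j with
    | zero => simp
    | succ j ih =>
      intro hj
      have h1 := ih (by omega)
      have h2 := hpoint (a + j) (hδ j (by omega)) (by simpa [add_assoc] using hδ (j + 1) hj)
      have h3 (ρ : Measure ℤ) [IsProbabilityMeasure ρ] :
          ρ.real (A ∩ Set.Ico a (a + (j + 1 : ℕ)))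
            = ρ.real (A ∩ Set.Ico a (a + j)) + ρ.real (A ∩ {a + (j : ℤ)}) := by
        rw [← measureReal_union _ (MeasurableSet.of_discrete)]
        · congr 1
          ext x
          simp only [Set.mem_inter_iff, Set.mem_Ico, Set.mem_union, Set.mem_singleton_iff]
          rw [← and_or_left]
          refine and_congr_right fun _ => ?_
          push_cast
          omega
        · refine Set.disjoint_left.2 fun x hx hx' => ?_
          have e1 := hx.2.2
          have e2 : x = a + j := hx'.2
          omega
      rw [h3, h3]
      push_cast
      rw [abs_le] at *
      constructor <;> linarith
  have h1 := hmid k le_rfl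
  have hsplit (ρ : Measure ℤ) [IsProbabilityMeasure ρ] := measureReal_inter_add_sdiff (μ := ρ)
    (s := A) (measurableSet_Ico (a := a) (b := a + k))
  have hrest (ρ : Measure ℤ) [IsProbabilityMeasure ρ] :
      ρ.real (A \ Set.Ico a (a + k)) ≤ ρ.real (Set.Ico a (a + k))ᶜ :=
    measureReal_mono fun _ h => h.2
  have h2 := hsplit μ
  have h3 := hsplit ν
  have h4 := hrest μ
  have h5 := hrest ν
  rw [hout] at h4 h5
  have h6 := hδ 0 (Nat.zero_le _)
  have h7 := hδ k le_rfl
  rw [Nat.cast_zero, add_zero] at h6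
  have h8 : 0 ≤ μ.real (A \ Set.Ico a (a + k)) := measureReal_nonneg
  have h9 : 0 ≤ ν.real (A \ Set.Ico a (a + k)) := measureReal_nonneg
  have h10 := (abs_nonneg _).trans h6
  rw [abs_le] at *
  constructor <;> linarith

theorem centeredSizeLaw_real_Ici (n m : ℕ) :
    (centeredSizeLaw n).real (Set.Ici (m - ⌊Real.logb 2 n⌋)) = sizeTail m n := by
  have hm : Measurable fun x => (greedySize n x : ℤ) - ⌊Real.logb 2 n⌋ :=
    (measurable_of_countable fun k : ℕ => (k : ℤ) - ⌊Real.logb 2 n⌋).comp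
      (measurable_greedySize n)
  rw [← graphOrderMeasure_le_greedySize, measureReal_def, measureReal_def, centeredSizeLaw,
    Measure.map_apply hm measurableSet_Ici]
  congr 2
  ext x
  simp

/-- After taking logarithms, `⌊log₂ n⌋` cancels against the fractional part. -/
theorem hLaw_real_Ici {n : ℕ} (hn : 0 < n) (m : ℕ) :
    (hLaw n).real (Set.Ici (m - ⌊Real.logb 2 n⌋))
      = expSeqMeasure.real {ω | 2 ^ m * hypo ω ≤ n} := by
  have hm : AEMeasurable (fun ω => ⌊Real.logb 2 (1 / hypo ω) + Int.fract (Real.logb 2 n)⌋)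
      expSeqMeasure := by
    have : Measurable fun x : ℝ => ⌊Real.logb 2 (1 / x) + Int.fract (Real.logb 2 n)⌋ := by
      unfold Real.logb
      fun_prop
    exact this.comp_aemeasurable aemeasurable_hypo
  rw [measureReal_def, measureReal_def, hLaw,
    Measure.map_apply_of_aemeasurable hm measurableSet_Ici]
  congr 1
  refine measure_congr ?_
  filter_upwards [ae_hypo_pos] with ω hω
  refine propext ?_
  change (m - ⌊Real.logb 2 n⌋ ≤ ⌊Real.logb 2 (1 / hypo ω) + Int.fract (Real.logb 2 n)⌋)
    ↔ 2 ^ m * hypo ω ≤ n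
  have hn' : (0 : ℝ) < n := by exact_mod_cast hn
  rw [← Real.logb_le_logb (b := 2) (by norm_num) (by positivity) hn',
    Real.logb_mul (by positivity) hω.ne', Real.logb_pow, Real.logb_self_eq_one (by norm_num),
    Int.le_floor, one_div, Real.logb_inv, Int.fract]
  push_cast
  constructor <;> intro h <;> linarith

/-! ### The rate of convergence -/

theorem rpow_le_two_pow_ceil {x : ℝ} (hx : 1 ≤ x) {s : ℝ} (hs : 0 ≤ s) :
    x ^ s ≤ 2 ^ ⌈s * Real.logb 2 x⌉₊ ∧ (2 : ℝ) ^ ⌈s * Real.logb 2 x⌉₊ ≤ 2 * x ^ s := by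
  have hx0 : 0 < x := by linarith
  have h : x ^ s = 2 ^ (s * Real.logb 2 x) := by
    rw [mul_comm, Real.rpow_mul (by norm_num), Real.rpow_logb (by norm_num) (by norm_num) hx0]
  have hl : 0 ≤ Real.logb 2 x := Real.logb_nonneg (by norm_num) hx
  rw [h, ← Real.rpow_natCast]
  constructor
  · exact Real.rpow_le_rpow_of_exponent_le (by norm_num) (Nat.le_ceil _)
  · have h2 : (2 : ℝ) * 2 ^ (s * Real.logb 2 x) = 2 ^ (s * Real.logb 2 x + 1) := by
      rw [Real.rpow_add_one (by norm_num), mul_comm]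
    rw [h2]
    exact Real.rpow_le_rpow_of_exponent_le (by norm_num)
      (Nat.ceil_lt_add_one (by positivity)).le

/-- With `2 ^ a ≈ n ^ α` and `c = n ^ β`, the errors `c / 2 ^ a`, `2 ^ a / n` and `1 / c` balance at
`α = 2/3`, `β = 1/3`. The upper end `2 ^ b ≥ n ^ 2` is generous, leaving mass at most `2 / n`. -/
theorem tvDist_centeredSizeLaw_hLaw_le {n : ℕ} (hn : 0 < n) :
    tvDist (centeredSizeLaw n) (hLaw n)
      ≤ 10 * (⌈2 * Real.logb 2 n⌉₊ + 1) ^ 2 * (n : ℝ) ^ (-(1 / 3) : ℝ) := by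
  have hx : (1 : ℝ) ≤ n := by exact_mod_cast hn
  have hx0 : (0 : ℝ) < n := by linarith
  obtain ⟨ha, ha'⟩ := rpow_le_two_pow_ceil hx (s := 2 / 3) (by norm_num)
  obtain ⟨hb, -⟩ := rpow_le_two_pow_ceil hx (s := 2) (by norm_num)
  have hab : ⌈2 / 3 * Real.logb 2 n⌉₊ ≤ ⌈2 * Real.logb 2 n⌉₊ := by
    have := Real.logb_nonneg (b := 2) (by norm_num) hx
    exact Nat.ceil_le_ceil (by linarith)
  set a := ⌈2 / 3 * Real.logb 2 n⌉₊
  set b := ⌈2 * Real.logb 2 n⌉₊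
  set c : ℝ := (n : ℝ) ^ (1 / 3 : ℝ) with hc
  have hc1 : 1 ≤ c := Real.one_le_rpow hx (by norm_num)
  have hc0 : 0 < c := by linarith
  have hc2 : (n : ℝ) ^ (2 / 3 : ℝ) = c ^ 2 := by
    rw [hc, ← Real.rpow_natCast, ← Real.rpow_mul hx0.le]; norm_num
  have hc3 : (n : ℝ) = c ^ 3 := by
    rw [hc, ← Real.rpow_natCast, ← Real.rpow_mul hx0.le]; norm_num
  have hr : (n : ℝ) ^ (-(1 / 3) : ℝ) = 1 / c := by
    rw [hc, Real.rpow_neg hx0.le]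
    exact (one_div _).symm
  rw [hc2] at ha ha'
  rw [Real.rpow_two] at hb
  have hδ : ∀ i ≤ b - a, |(centeredSizeLaw n).real (Set.Ici ((a : ℤ) - ⌊Real.logb 2 n⌋ + i))
      - (hLaw n).real (Set.Ici ((a : ℤ) - ⌊Real.logb 2 n⌋ + i))| ≤ 3 * (b + 1) / c := by
    intro i hi
    have e : (a : ℤ) - ⌊Real.logb 2 n⌋ + i = (a + i : ℕ) - ⌊Real.logb 2 n⌋ := by
      push_cast; ring
    rw [e, centeredSizeLaw_real_Ici, hLaw_real_Ici hn]
    refine (abs_sizeTail_sub_le (a + i) n hc0).trans ?_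
    have hib : ((a + i : ℕ) : ℝ) ≤ b := by exact_mod_cast (by omega : a + i ≤ b)
    have hp : c ^ 2 ≤ 2 ^ (a + i) :=
      ha.trans (pow_le_pow_right₀ (by norm_num) (Nat.le_add_right _ _))
    calc 2 * (((a + i : ℕ) : ℝ) + c) / 2 ^ (a + i) + (((a + i : ℕ) : ℝ) + 1) / c
        ≤ 2 * (b * c + c) / c ^ 2 + (b + 1) / c := by
          gcongr
          exact hib.trans (le_mul_of_one_le_right (Nat.cast_nonneg _) hc1)
      _ = 3 * (b + 1) / c := by field_simp; ring
  have hη : 1 - (hLaw n).real (Set.Ici ((a : ℤ) - ⌊Real.logb 2 n⌋))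
      + (hLaw n).real (Set.Ici ((a : ℤ) - ⌊Real.logb 2 n⌋ + (b - a : ℕ))) ≤ 4 / c := by
    have e : (a : ℤ) - ⌊Real.logb 2 n⌋ + (b - a : ℕ) = (b : ℕ) - ⌊Real.logb 2 n⌋ := by
      push_cast [hab]; ring
    rw [e, hLaw_real_Ici hn, hLaw_real_Ici hn]
    have h1 := expSeqMeasure_mul_hypo_le_le (a := 2 ^ b) (b := n) (by positivity) hx0.le
    have h2 := expSeqMeasure_lt_mul_hypo_le (a := 2 ^ a) (b := n) (by positivity) hx0
    have h3 : 1 - expSeqMeasure.real {ω | 2 ^ a * hypo ω ≤ n}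
        ≤ expSeqMeasure.real {ω | (n : ℝ) < 2 ^ a * hypo ω} := by
      have h := measureReal_union_le (μ := expSeqMeasure) {ω | 2 ^ a * hypo ω ≤ n}
        {ω | (n : ℝ) < 2 ^ a * hypo ω}
      have hu : {ω | 2 ^ a * hypo ω ≤ n} ∪ {ω | (n : ℝ) < 2 ^ a * hypo ω} = Set.univ := by
        ext ω
        simpa using le_or_gt _ _
      rw [hu, probReal_univ] at h
      linarith
    have h4 : (2 : ℝ) ^ a / n ≤ 2 / c := by
      calc (2 : ℝ) ^ a / n ≤ 2 * c ^ 2 / n := by gcongr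
        _ = 2 / c := by rw [hc3]; field_simp
    have h5 : 2 * ((n : ℝ) / 2 ^ b) ≤ 2 / c := by
      calc 2 * ((n : ℝ) / 2 ^ b) ≤ 2 * (n / n ^ 2) := by gcongr
        _ = 2 / n := by field_simp
        _ ≤ 2 / c := by
          gcongr
          rw [hc3]
          exact le_self_pow₀ hc1 (by norm_num)
    have h6 : 4 / c = 2 / c + 2 / c := by ring
    linarith
  refine (tvDist_le_of_abs_tail_sub_le _ _ _ _ hδ hη).trans ?_
  rw [hr]
  have hk : ((b - a : ℕ) : ℝ) ≤ b := by exact_mod_cast Nat.sub_le _ _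
  have hb0 : (0 : ℝ) ≤ b := Nat.cast_nonneg _
  calc (2 * ((b - a : ℕ) : ℝ) + 2) * (3 * (b + 1) / c) + 4 / c
      ≤ (2 * b + 2) * (3 * (b + 1) / c) + 4 * (b + 1) ^ 2 / c := by
        gcongr
        nlinarith
    _ = 10 * (b + 1) ^ 2 * (1 / c) := by ring

end

theorem corollary1 :
    IsSoftO (fun n : ℕ => tvDist (centeredSizeLaw n) (hLaw n))
      (fun n : ℕ => (n : ℝ) ^ (-(1 / 3) : ℝ)) := by
  -- One logarithm counts the points of the window, the other comes from the factors `m` in the tail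
  -- comparison; `360 = 10 * 6 ^ 2`.
  refine ⟨2, IsBigO.of_bound 360 ?_⟩
  filter_upwards [eventually_ge_atTop 3] with n hn
  have hn3 : (3 : ℝ) ≤ n := by exact_mod_cast hn
  have hlog : 1 ≤ Real.log n := by
    rw [Real.le_log_iff_exp_le (by linarith)]
    linarith [Real.exp_one_lt_d9]
  -- As `1 / log 2 < 2` and `log n ≥ 1`, the left side is at most `4 * log n + 2 ≤ 6 * log n`.
  have hceil : (⌈2 * Real.logb 2 n⌉₊ : ℝ) + 1 ≤ 6 * Real.log n := by
    have h1 : Real.logb 2 n ≤ 2 * Real.log n := by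
      rw [Real.logb, div_le_iff₀ (Real.log_pos (by norm_num))]
      nlinarith [Real.log_two_gt_d9]
    have h2 := Nat.ceil_lt_add_one (a := 2 * Real.logb 2 n)
      (mul_nonneg (by norm_num) (Real.logb_nonneg (by norm_num) (by linarith)))
    linarith
  have htv : 0 ≤ tvDist (centeredSizeLaw n) (hLaw n) := Real.iSup_nonneg fun _ => abs_nonneg _
  rw [Real.norm_of_nonneg htv, Real.norm_of_nonneg (by positivity)]
  calc tvDist (centeredSizeLaw n) (hLaw n)
      ≤ 10 * (⌈2 * Real.logb 2 n⌉₊ + 1) ^ 2 * (n : ℝ) ^ (-(1 / 3) : ℝ) :=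
        tvDist_centeredSizeLaw_hLaw_le (by omega)
    _ ≤ 10 * (6 * Real.log n) ^ 2 * (n : ℝ) ^ (-(1 / 3) : ℝ) := by gcongr
    _ = 360 * ((n : ℝ) ^ (-(1 / 3) : ℝ) * Real.log n ^ 2) := by ring
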